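/- Let $n,m\ge 1$ be integers, let $\mathbb R^n$ carry the Euclidean norm, let $f=(f_1,\dots,f_m)\colon\mathbb R^n\to\mathbb R^m$ be locally Lipschitz, and let $\Omega\subset\mathbb R^n$ be nonempty and closed. For $a,b\in\mathbb R^m$ write $a\leqq b$ if $a_i\le b_i$ for all $i$. A point $\bar x\in\Omega$ is a Pareto efficient solution of the problem (VP) of minimizing $f$ over $\Omega$ if there is no $x\in\Omega$ with $f(x)\leqq f(\bar x)$ and $f(x)\neq f(\bar x)$. For $\bar y\in\mathbb R^m$ the section $[f(\Omega)]_{\bar y}:=\{y\in f(\Omega): y\leqq\bar y\}$ is bounded if there is $a\in\mathbb R^m$ with $a\leqq y$ for all $y\in[f(\Omega)]_{\bar y}$. For a subset $S$ of a Euclidean space and a point $x\in S$ let $\widehat N(x;S)$ be the set of all $v$ with $\langle v,z-x\rangle\le o(\|z-x\|)$ as $z\to x$, $z\in S$. Let $N(x;S)$ be the set of all limits of sequences $v^k\in\widehat N(x^k;S)$ with $x^k\in S$, $x^k\to x$. For $\phi\colon\mathbb R^n\to\mathbb R$ let $\partial\phi(x)$ be the set of all $v\in\mathbb R^n$ with $(v,-1)\in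 N\big((x,\phi(x));\{(z,t)\in\mathbb R^n\times\mathbb R:\phi(z)\le t\}\big)$. The Rabier function is $$\nu(x):=\inf\Big\{\Big\|\sum_{i=1}^m\lambda_iv^i+w\Big\| : v^i\in\partial f_i(x)\cup\partial(-f_i)(x),\ w\in N(x;\Omega),\ \lambda_i\ge0,\ \sum_{i=1}^m\lambda_i=1\Big\},$$ and $\Gamma(f,\Omega)$ is the set of all $x\in\Omega$ for which there are $v^i\in\partial f_i(x)\cup\partial(-f_i)(x)$ and $(\lambda,\mu)\in\mathbb R^m\times\mathbb R$ with all $\lambda_i\ge0$ and $\sum_{i=1}^m\lambda_i+|\mu|=1$ such that $0\in\sum_{i=1}^m\lambda_iv^i+\mu x+N(x;\Omega)$. For $\bar y\in\mathbb R^m$ let $\widetilde K_{\infty,\leqq\bar y}$ (respectively $K_{\infty,\leqq\bar y}$) be the set of all $y\in\mathbb R^m$ for which there is a sequence $x^k\in\Omega$ with $f(x^k)\leqq\bar y$ for all $k$, $\|x^k\|\to\infty$, $f(x^k)\to y$ and $\nu(x^k)\to0$ (respectively $\|x^k\|\,\nu(x^k)\to0$). Let $T_{\infty,\leqq\bar y}$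 be the set of all $y\in\mathbb R^m$ for which there is a sequence $x^k\in\Gamma(f,\Omega)$ with $f(x^k)\leqq\bar y$ for all $k$, $\|x^k\|\to\infty$ and $f(x^k)\to y$. Finally let $K_{0,\leqq\bar y}:=\{f(x): x\in\Omega,\ f(x)\leqq\bar y,\ \nu(x)=0\}$. Theorem 4.1. The following assertions are equivalent: (i) Problem (VP) has a Pareto efficient solution. (ii) There is $\bar y\in f(\Omega)$ such that the section $[f(\Omega)]_{\bar y}$ is bounded and $\widetilde K_{\infty,\leqq\bar y}\subset K_{0,\leqq\bar y}$. (iii) There is $\bar y\in f(\Omega)$ such that the section $[f(\Omega)]_{\bar y}$ is bounded and $K_{\infty,\leqq\bar y}\subset K_{0,\leqq\bar y}$. (iv) There is $\bar y\in f(\Omega)$ such that the section $[f(\Omega)]_{\bar y}$ is bounded and $T_{\infty,\leqq\bar y}\subset K_{0,\leqq\bar y}$. -/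

import Mathlib

open Filter Topology

namespace VecOpt

/-- The space `ℝⁿ` with the Euclidean norm and the usual scalar product. -/
abbrev E (n : ℕ) : Type := EuclideanSpace ℝ (Fin n)

section Normals

variable {F : Type*} [NormedAddCommGroup F] [InnerProductSpace ℝ F]

/-- The regular (Fréchet) normal cone to `S` at `a`: all `v` with
`⟨v, x - a⟩ ≤ o(‖x - a‖)` as `x → a`, `x ∈ S`. -/
def regularNormalCone (a : F) (S : Set F) : Set F :=
  {v | ∀ ε : ℝ, 0 < ε → ∀ᶠ x in 𝓝[S] a, inner ℝ v (x - a) ≤ ε * ‖x - a‖}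

/-- The limiting (Mordukhovich) normal cone to `S` at `a`: all limits of regular normals
`vᵏ` to `S` at points `xᵏ ∈ S` with `xᵏ → a`. -/
def limitingNormalCone (a : F) (S : Set F) : Set F :=
  {v | ∃ (x : ℕ → F) (u : ℕ → F), (∀ k, x k ∈ S) ∧ (∀ k, u k ∈ regularNormalCone (x k) S) ∧
    Tendsto x atTop (𝓝 a) ∧ Tendsto u atTop (𝓝 v)}

end Normals

/-- The epigraph of `φ : ℝⁿ → ℝ`, in `ℝⁿ × ℝ` with its Euclidean (`ℓ²`) structure. -/
def epigraph {n : ℕ} (φ : E n → ℝ) : Set (WithLp 2 (E n × ℝ)) :=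
  {p | φ p.fst ≤ p.snd}

/-- The limiting subdifferential `∂φ(a)`: all `v` such that `(v, -1)` is a limiting normal to
the epigraph of `φ` at `(a, φ a)`. -/
def subdifferential {n : ℕ} (φ : E n → ℝ) (a : E n) : Set (E n) :=
  {v | WithLp.toLp 2 (v, (-1 : ℝ)) ∈
    limitingNormalCone (WithLp.toLp 2 (a, φ a)) (epigraph φ)}

variable {n m : ℕ}

/-- `x` is a Pareto efficient solution of the problem of minimizing `f` over `Ω` with respect
to the componentwise order (the order `≤` of `Fin m → ℝ`). -/
def IsParetoEfficient (f : E n → Fin m → ℝ) (Ω : Set (E n)) (x : E n) : Prop :=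
  x ∈ Ω ∧ ¬ ∃ z ∈ Ω, f z ≤ f x ∧ f z ≠ f x

/-- The section `[A]_y = A ∩ (y - ℝᵐ₊)` of `A` at `y`. -/
def sectionAt (A : Set (Fin m → ℝ)) (y : Fin m → ℝ) : Set (Fin m → ℝ) :=
  {z | z ∈ A ∧ z ≤ y}

/-- The section `[A]_y` is bounded: `[A]_y ⊆ a + ℝᵐ₊` for some vector `a`. -/
def HasBoundedSection (A : Set (Fin m → ℝ)) (y : Fin m → ℝ) : Prop :=
  ∃ a : Fin m → ℝ, ∀ z ∈ sectionAt A y, a ≤ z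

/-- The set `∂fᵢ(x) ∪ ∂(-fᵢ)(x)`. -/
def twoSidedSubdifferential (f : E n → Fin m → ℝ) (x : E n) (i : Fin m) : Set (E n) :=
  subdifferential (fun z => f z i) x ∪ subdifferential (fun z => -f z i) x

/-- All vectors `∑ λᵢ vⁱ + w` with `vⁱ ∈ ∂fᵢ(x) ∪ ∂(-fᵢ)(x)`, `w ∈ N(x; Ω)`, `λ ≥ 0` and
`∑ λᵢ = 1`. -/
def rabierSet (f : E n → Fin m → ℝ) (Ω : Set (E n)) (x : E n) : Set (E n) :=
  {u | ∃ (v : Fin m → E n) (w : E n) (l : Fin m → ℝ),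
    (∀ i, v i ∈ twoSidedSubdifferential f x i) ∧ w ∈ limitingNormalCone x Ω ∧
    (∀ i, 0 ≤ l i) ∧ ∑ i, l i = 1 ∧ u = ∑ i, l i • v i + w}

/-- The extended Rabier function `ν`: the infimum of the norms of the vectors of `rabierSet`,
with values in `[0, ∞]` (the infimum of the empty set is `∞`). -/
noncomputable def rabier (f : E n → Fin m → ℝ) (Ω : Set (E n)) (x : E n) : ENNReal :=
  ⨅ u ∈ rabierSet f Ω x, ‖u‖ₑ

/-- The set `K̃_{∞, ≦ b}(f, Ω)`. -/
def KTildeInfty (f : E n → Fin m → ℝ) (Ω : Set (E n)) (b : Fin m → ℝ) : Set (Fin m → ℝ) :=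
  {y | ∃ x : ℕ → E n, (∀ k, x k ∈ Ω) ∧ (∀ k, f (x k) ≤ b) ∧
    Tendsto (fun k => ‖x k‖) atTop atTop ∧ Tendsto (fun k => f (x k)) atTop (𝓝 y) ∧
    Tendsto (fun k => rabier f Ω (x k)) atTop (𝓝 0)}

/-- The set `K_{∞, ≦ b}(f, Ω)`. -/
def KInfty (f : E n → Fin m → ℝ) (Ω : Set (E n)) (b : Fin m → ℝ) : Set (Fin m → ℝ) :=
  {y | ∃ x : ℕ → E n, (∀ k, x k ∈ Ω) ∧ (∀ k, f (x k) ≤ b) ∧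
    Tendsto (fun k => ‖x k‖) atTop atTop ∧ Tendsto (fun k => f (x k)) atTop (𝓝 y) ∧
    Tendsto (fun k => ‖x k‖ₑ * rabier f Ω (x k)) atTop (𝓝 0)}

/-- The set `Γ(f, Ω)`. -/
def Gam (f : E n → Fin m → ℝ) (Ω : Set (E n)) : Set (E n) :=
  {x | x ∈ Ω ∧ ∃ v : Fin m → E n, (∀ i, v i ∈ twoSidedSubdifferential f x i) ∧
    ∃ (l : Fin m → ℝ) (μ : ℝ), (∀ i, 0 ≤ l i) ∧ ∑ i, l i + |μ| = 1 ∧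
      ∃ w ∈ limitingNormalCone x Ω, 0 = ∑ i, l i • v i + μ • x + w}

/-- The set `T_{∞, ≦ b}(f, Ω)`. -/
def TInfty (f : E n → Fin m → ℝ) (Ω : Set (E n)) (b : Fin m → ℝ) : Set (Fin m → ℝ) :=
  {y | ∃ x : ℕ → E n, (∀ k, x k ∈ Gam f Ω) ∧ (∀ k, f (x k) ≤ b) ∧
    Tendsto (fun k => ‖x k‖) atTop atTop ∧ Tendsto (fun k => f (x k)) atTop (𝓝 y)}

/-- The set `K_{0, ≦ b}(f, Ω)` of values `f(x)`, `x ∈ Ω`, `f(x) ≦ b`, with `ν(x) = 0`. -/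
def KZero (f : E n → Fin m → ℝ) (Ω : Set (E n)) (b : Fin m → ℝ) : Set (Fin m → ℝ) :=
  {y | ∃ x ∈ Ω, f x ≤ b ∧ rabier f Ω x = 0 ∧ y = f x}

end VecOpt

/-! If `a` is efficient, the section at `f a` contains only `f a`, so every asymptotic value there
equals `f a`. Since `a` minimizes `∑ fᵢ` on `{z ∈ Ω | f z ≤ f a}`, the multiplier rule
`exists_multipliers` gives `ν(a) = 0`. Hence (i) implies (ii) and (iv).

Conversely, on a bounded section minimize `∑ fᵢ + ε log (1 + ‖·‖²)` with `ε → 0`. Minimizers exist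
by coercivity; by the multiplier rule they lie in `Γ(f, Ω)` and satisfy `‖x‖ ν(x) ≤ 2ε`. Their
values accumulate at some `y` whose coordinate sum is at most that of every value in the section.
Either the minimizers escape to infinity, and `y` is attained because it lies in both `KInfty` and
`TInfty`, or a cluster point attains it. A point of the section minimizing `∑ fᵢ` is efficient.

The multiplier rule uses no subdifferential sum rule: each `fᵢ` gets its own copy of the variable,
quadratic penalties tie the copies together and enforce `f ≤ b`, and Fermat's rule is applied in
each variable separately. -/

namespace VecOpt

/-! ### Normal cones and Fermat's rule. -/

section Normals

variable {F : Type*} [NormedAddCommGroup F] [InnerProductSpace ℝ F]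

theorem smul_mem_regularNormalCone {a : F} {S : Set F} {v : F}
    (hv : v ∈ regularNormalCone a S) {c : ℝ} (hc : 0 < c) : c • v ∈ regularNormalCone a S := by
  intro ε hε
  filter_upwards [hv (ε / c) (by positivity)] with x hx
  rw [real_inner_smul_left]
  calc c * inner ℝ v (x - a) ≤ c * (ε / c * ‖x - a‖) := by gcongr
    _ = ε * ‖x - a‖ := by field_simp

theorem smul_mem_limitingNormalCone {a : F} {S : Set F} {v : F}
    (hv : v ∈ limitingNormalCone a S) {c : ℝ} (hc : 0 < c) : c • v ∈ limitingNormalCone a S := by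
  obtain ⟨x, u, hx, hu, hxa, huv⟩ := hv
  exact ⟨x, fun k => c • u k, hx, fun k => smul_mem_regularNormalCone (hu k) hc, hxa,
    huv.const_smul c⟩

/-- Fermat's rule: the negative gradient at a local minimizer over `S` is a regular normal. -/
theorem neg_mem_regularNormalCone_of_isMin {a g : F} {S : Set F} {ψ : F → ℝ}
    (hψ : HasFDerivAt ψ (innerSL ℝ g) a) (hmin : ∀ᶠ x in 𝓝[S] a, ψ a ≤ ψ x) :
    -g ∈ regularNormalCone a S := by
  intro ε hε
  have h := (hasFDerivAt_iff_isLittleO.1 hψ).def hε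
  filter_upwards [hmin, h.filter_mono nhdsWithin_le_nhds] with x hx hx'
  rw [Real.norm_eq_abs, innerSL_apply_apply] at hx'
  rw [inner_neg_left]
  linarith [(abs_le.1 hx').2]

end Normals

variable {n m : ℕ}

/-! ### Regular subgradients and the penalty function. -/

theorem tendsto_toLp_prodMk {ι : Type*} {l : Filter ι} {u : ι → E n} {t : ι → ℝ} {a : E n} {c : ℝ}
    (hu : Tendsto u l (𝓝 a)) (ht : Tendsto t l (𝓝 c)) :
    Tendsto (fun j => WithLp.toLp 2 (u j, t j)) l (𝓝 (WithLp.toLp 2 (a, c))) :=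
  ((WithLp.prod_continuous_toLp 2 (E n) ℝ).tendsto (a, c)).comp (hu.prodMk_nhds ht)

/-- A regular subgradient of a Lipschitz function is bounded in terms of the Lipschitz constant. -/
theorem norm_le_of_mem_regularNormalCone_epigraph {φ : E n → ℝ} {z v : E n} {K : ℝ} (hK : 0 ≤ K)
    (hφ : ∀ᶠ y in 𝓝 z, |φ y - φ z| ≤ K * ‖y - z‖)
    (hv : WithLp.toLp 2 (v, (-1 : ℝ)) ∈
      regularNormalCone (WithLp.toLp 2 (z, φ z)) (epigraph φ)) : ‖v‖ ≤ 2 * K + 1 := by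
  have hcont : ContinuousAt φ z := by
    rw [ContinuousAt, tendsto_iff_norm_sub_tendsto_zero]
    refine squeeze_zero' (Eventually.of_forall fun _ => norm_nonneg _) hφ ?_
    have : Continuous fun y : E n => K * ‖y - z‖ := by fun_prop
    simpa using this.tendsto z
  have hlim : Tendsto (fun y : E n => WithLp.toLp 2 (y, φ y)) (𝓝 z)
      (𝓝[epigraph φ] (WithLp.toLp 2 (z, φ z))) := by
    refine tendsto_nhdsWithin_iff.2 ⟨?_, Eventually.of_forall fun y => le_refl (φ y)⟩
    exact tendsto_toLp_prodMk tendsto_id hcont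
  have h1 := hlim.eventually (hv 1 one_pos)
  -- Test the normal along `z + s • v`. With `Δ` the increment of `φ`, it gives `s‖v‖² - Δ ≤ s‖v‖ +
  -- |Δ|`, and `|Δ| ≤ K s‖v‖` yields `‖v‖ ≤ 2K + 1`.
  have hray : Tendsto (fun s : ℝ => z + s • v) (𝓝[>] 0) (𝓝 z) := by
    have : Continuous fun s : ℝ => z + s • v := by fun_prop
    simpa using (this.tendsto 0).mono_left nhdsWithin_le_nhds
  obtain ⟨s, ⟨hs1, hs2⟩, hs⟩ :=
    ((hray.eventually (h1.and hφ)).and self_mem_nhdsWithin).exists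
  replace hs : 0 < s := hs
  rw [add_sub_cancel_left, norm_smul, Real.norm_of_nonneg hs.le] at hs2
  rw [← WithLp.toLp_sub, Prod.mk_sub_mk, add_sub_cancel_left, WithLp.prod_inner_apply] at hs1
  have hnorm : ‖WithLp.toLp 2 (s • v, φ (z + s • v) - φ z)‖
      ≤ s * ‖v‖ + |φ (z + s • v) - φ z| := by
    rw [WithLp.prod_norm_eq_of_L2]
    change √(‖s • v‖ ^ 2 + ‖φ (z + s • v) - φ z‖ ^ 2) ≤ _
    refine Real.sqrt_le_iff.2 ⟨by positivity, ?_⟩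
    simp only [norm_smul, Real.norm_of_nonneg hs.le, Real.norm_eq_abs]
    nlinarith [mul_nonneg (mul_nonneg hs.le (norm_nonneg v)) (abs_nonneg (φ (z + s • v) - φ z))]
  simp only [real_inner_smul_right, real_inner_self_eq_norm_sq, RCLike.inner_apply,
    conj_trivial] at hs1
  have h2 := abs_le.1 hs2
  by_contra! hcon
  have hv0 : 0 < ‖v‖ := by linarith
  nlinarith [mul_pos (mul_pos hs hv0) (sub_pos.2 hcon)]

theorem hasDerivAt_posPart_sq (t : ℝ) :
    HasDerivAt (fun s : ℝ => (max s 0) ^ 2) (2 * max t 0) t := by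
  rcases lt_trichotomy t 0 with h | h | h
  · rw [max_eq_right h.le, mul_zero]
    refine (hasDerivAt_const t (0 : ℝ)).congr_of_eventuallyEq ?_
    filter_upwards [gt_mem_nhds h] with s hs
    simp [max_eq_right hs.le]
  · subst h
    rw [max_self, mul_zero, hasDerivAt_iff_isLittleO]
    have : (fun s : ℝ => s ^ 2) =o[𝓝 0] fun s => s := by
      simpa using Asymptotics.isLittleO_pow_pow (𝕜 := ℝ) (m := 1) (n := 2) one_lt_two
    simp only [max_self, sub_zero, smul_zero]
    refine Asymptotics.IsBigO.trans_isLittleO (Asymptotics.IsBigO.of_bound 1 ?_) this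
    refine Eventually.of_forall fun s => ?_
    rcases le_total s 0 with hs | hs
    · simp [max_eq_right hs]; positivity
    · simp [max_eq_left hs]
  · rw [max_eq_left h.le]
    refine HasDerivAt.congr_of_eventuallyEq (f := fun s => s ^ 2) ?_ ?_
    · simpa using hasDerivAt_pow 2 t
    · filter_upwards [lt_mem_nhds h] with s hs
      rw [max_eq_left hs.le]

/-- The quadratically penalized objective of `min t` subject to `t ≤ c`. -/
noncomputable def penalty (k c t : ℝ) : ℝ := t + k / 2 * (max (t - c) 0) ^ 2

theorem hasDerivAt_penalty (k c t : ℝ) :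
    HasDerivAt (penalty k c) (1 + k * max (t - c) 0) t := by
  have h := (hasDerivAt_posPart_sq (t - c)).comp_sub_const t c
  refine ((hasDerivAt_id t).add (h.const_mul (k / 2))).congr_deriv ?_
  ring

theorem penalty_mono {k : ℝ} (hk : 0 ≤ k) (c : ℝ) : Monotone (penalty k c) := by
  intro s t hst
  unfold penalty
  gcongr

theorem penalty_of_le {k c t : ℝ} (h : t ≤ c) : penalty k c t = t := by
  simp [penalty, max_eq_right (sub_nonpos.2 h)]

/-- A local minimizer of `h ∘ φ + k/2 ‖· - y‖²` with `h` increasing yields a regular subgradient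
of `φ`. -/
theorem regularNormal_epigraph_of_isMin {φ : E n → ℝ} {z y : E n}
    {k c : ℝ} (hk : 0 ≤ k)
    (hmin : ∀ᶠ x in 𝓝 z,
      penalty k c (φ z) + k / 2 * ‖z - y‖ ^ 2 ≤ penalty k c (φ x) + k / 2 * ‖x - y‖ ^ 2) :
    WithLp.toLp 2 ((k / (1 + k * max (φ z - c) 0)) • (y - z), (-1 : ℝ)) ∈
      regularNormalCone (WithLp.toLp 2 (z, φ z)) (epigraph φ) := by
  set α : ℝ := 1 + k * max (φ z - c) 0 with hα
  have hα0 : 0 < α := by positivity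
  set a : WithLp 2 (E n × ℝ) := WithLp.toLp 2 (z, φ z) with ha
  have hfst : HasFDerivAt (fun p : WithLp 2 (E n × ℝ) => p.fst)
      (WithLp.fstL 2 ℝ (E n) ℝ) a := (WithLp.fstL 2 ℝ (E n) ℝ).hasFDerivAt
  have hsnd : HasFDerivAt (fun p : WithLp 2 (E n × ℝ) => p.snd)
      (WithLp.sndL 2 ℝ (E n) ℝ) a := (WithLp.sndL 2 ℝ (E n) ℝ).hasFDerivAt
  have h1 := (hasDerivAt_penalty k c (φ z)).comp_hasFDerivAt a hsnd
  have h2 := ((hfst.sub_const y).norm_sq).const_mul (k / 2)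
  have hd : HasFDerivAt
      (fun p : WithLp 2 (E n × ℝ) => penalty k c p.snd + k / 2 * ‖p.fst - y‖ ^ 2)
      (innerSL ℝ (WithLp.toLp 2 (k • (z - y), α))) a := by
    refine (h1.add h2).congr_fderiv ?_
    ext p
    simp [WithLp.prod_inner_apply, real_inner_smul_left, inner_sub_left, ha, hα]
    ring
  have hN : -(WithLp.toLp 2 (k • (z - y), α)) ∈ regularNormalCone a (epigraph φ) := by
    refine neg_mem_regularNormalCone_of_isMin hd ?_
    have hcont : Tendsto (fun p : WithLp 2 (E n × ℝ) => p.fst) (𝓝[epigraph φ] a) (𝓝 z) :=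
      ((continuous_fst.comp (WithLp.prod_continuous_ofLp 2 (E n) ℝ)).tendsto a).mono_left
        nhdsWithin_le_nhds
    filter_upwards [hcont.eventually hmin, self_mem_nhdsWithin] with p hp hpe
    -- Monotonicity carries minimality from the graph to the whole epigraph.
    have := penalty_mono hk c hpe
    exact hp.trans (by gcongr)
  -- Dividing by `α` normalizes the last coordinate to `-1`.
  have := smul_mem_regularNormalCone hN (inv_pos.2 hα0)
  have he : WithLp.toLp 2 ((k / α) • (y - z), (-1 : ℝ))
      = α⁻¹ • -(WithLp.toLp 2 (k • (z - y), α)) := by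
    rw [← WithLp.toLp_neg, ← WithLp.toLp_smul]
    refine congrArg (WithLp.toLp 2) (Prod.ext ?_ ?_)
    · change (k / α) • (y - z) = α⁻¹ • -(k • (z - y))
      module
    · change (-1 : ℝ) = α⁻¹ * -α
      field_simp
  rw [he]
  exact this

/-! ### Multiplier rule by decoupling and penalization. -/

/-- Approximate multiplier rule at a minimizer of `∑ fᵢ + θ` on `{z ∈ Ω | f z ≤ b}`. -/
theorem exists_approx_multipliers (hm : 0 < m) {f : E n → Fin m → ℝ} (hf : Continuous f)
    {Ω : Set (E n)} (hcl : IsClosed Ω) {θ : E n → ℝ} {g : E n → E n}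
    (hθ : ∀ z, HasFDerivAt θ (innerSL ℝ (g z)) z) {b : Fin m → ℝ} {a : E n} (ha : a ∈ Ω)
    (hb : f a ≤ b) (hmin : ∀ z ∈ Ω, f z ≤ b → ∑ i, f a i + θ a ≤ ∑ i, f z i + θ z)
    {δ : ℝ} (hδ : 0 < δ) :
    ∃ (z₀ : E n) (z v : Fin m → E n) (l : Fin m → ℝ) (μ : ℝ),
      z₀ ∈ Ω ∧ dist z₀ a < δ ∧ (∀ i, dist (z i) a < δ) ∧
      (∀ i, WithLp.toLp 2 (v i, (-1 : ℝ)) ∈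
        regularNormalCone (WithLp.toLp 2 (z i, f (z i) i)) (epigraph fun y => f y i)) ∧
      (∀ i, 0 ≤ l i) ∧ ∑ i, l i = 1 ∧ 0 ≤ μ ∧ μ ≤ 1 ∧
      -(∑ i, l i • v i + μ • (g z₀ + (z₀ - a))) ∈ regularNormalCone z₀ Ω := by
  have hθc : Continuous θ := continuous_iff_continuousAt.2 fun z => (hθ z).continuousAt
  set V : ℝ := ∑ i, f a i + θ a with hV
  -- `p.1` is the base point and `p.2 i` the copy fed to `fᵢ`. `W` vanishes exactly when all copies
  -- equal the base point and `f ≤ b` there; the term `‖p.1 - a‖²` in `R` makes `a` the only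
  -- minimizer of the limit problem.
  let R : E n × (Fin m → E n) → ℝ := fun p =>
    ∑ i, f (p.2 i) i + (θ p.1 + 1 / 2 * ‖p.1 - a‖ ^ 2)
  let W : E n × (Fin m → E n) → ℝ := fun p =>
    ∑ i, (1 / 2 * (max (f (p.2 i) i - b i) 0) ^ 2 + 1 / 2 * ‖p.2 i - p.1‖ ^ 2)
  let Q : ℝ → E n × (Fin m → E n) → ℝ := fun k p =>
    ∑ i, (penalty k (b i) (f (p.2 i) i) + k / 2 * ‖p.2 i - p.1‖ ^ 2) +
      (θ p.1 + 1 / 2 * ‖p.1 - a‖ ^ 2)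
  have hQ : ∀ k p, Q k p = R p + k * W p := by
    intro k p
    simp only [Q, R, W, penalty, Finset.mul_sum, Finset.sum_add_distrib, mul_add]
    simp only [div_eq_mul_inv, mul_assoc, one_mul]
    ring
  have hRc : Continuous R := by fun_prop
  have hWc : Continuous W := by fun_prop
  have hW0 : ∀ p, 0 ≤ W p := fun p => Finset.sum_nonneg fun i _ => by positivity
  let D : Set (E n × (Fin m → E n)) :=
    (Ω ∩ Metric.closedBall a 1) ×ˢ Set.univ.pi fun _ => Metric.closedBall a 1
  have hD : IsCompact D := ((isCompact_closedBall a 1).inter_left hcl).prod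
    (isCompact_univ_pi fun _ => isCompact_closedBall a 1)
  have haD : (a, fun _ => a) ∈ D := by simp [D, ha]
  have hQa : ∀ k, Q k (a, fun _ => a) = V := by
    intro k
    simp [Q, hV, penalty_of_le (hb _)]
  have hex : ∀ j : ℕ, ∃ p ∈ D, ∀ q ∈ D, Q (j + 1) p ≤ Q (j + 1) q := by
    intro j
    obtain ⟨p, hp, hpm⟩ := hD.exists_isMinOn ⟨_, haD⟩
      (f := Q (j + 1)) (by
        have : Q (j + 1) = fun p => R p + (j + 1) * W p := funext (hQ _)
        rw [this]; exact (hRc.add (hWc.const_mul _)).continuousOn)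
    exact ⟨p, hp, fun q hq => hpm hq⟩
  choose p hpD hpmin using hex
  obtain ⟨q, hqD, φ, hφ, hq⟩ := hD.tendsto_subseq hpD
  have hle : ∀ j : ℕ, R (p j) + (j + 1) * W (p j) ≤ V := by
    intro j
    rw [← hQ, ← hQa (j + 1)]
    exact hpmin j _ haD
  have hRq : Tendsto (fun j => R (p (φ j))) atTop (𝓝 (R q)) := (hRc.tendsto q).comp hq
  have hWq : Tendsto (fun j => W (p (φ j))) atTop (𝓝 (W q)) := (hWc.tendsto q).comp hq
  have hRV : R q ≤ V := le_of_tendsto' hRq fun j => by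
    have := mul_nonneg (by positivity : (0 : ℝ) ≤ φ j + 1) (hW0 (p (φ j)))
    linarith [hle (φ j)]
  have hWq0 : W q = 0 := by
    refine le_antisymm ?_ (hW0 q)
    have hk : Tendsto (fun j => ((φ j : ℕ) : ℝ) + 1) atTop atTop :=
      tendsto_atTop_add_const_right _ _ (tendsto_natCast_atTop_atTop.comp hφ.tendsto_atTop)
    refine le_of_tendsto_of_tendsto' hWq ((hRq.const_sub V).div_atTop hk) fun j => ?_
    rw [le_div_iff₀ (by positivity)]
    linarith [hle (φ j)]
  have hterm := (Finset.sum_eq_zero_iff_of_nonneg fun i _ => by positivity).1 hWq0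
  have hq2 : ∀ i, q.2 i = q.1 := by
    intro i
    have h := hterm i (Finset.mem_univ i)
    have h1 : ‖q.2 i - q.1‖ ^ 2 = 0 := by
      nlinarith [sq_nonneg ‖q.2 i - q.1‖, sq_nonneg (max (f (q.2 i) i - b i) 0)]
    simpa [sub_eq_zero] using h1
  have hqb : f q.1 ≤ b := by
    intro i
    have h := hterm i (Finset.mem_univ i)
    have h1 : (max (f (q.2 i) i - b i) 0) ^ 2 = 0 := by
      nlinarith [sq_nonneg ‖q.2 i - q.1‖, sq_nonneg (max (f (q.2 i) i - b i) 0)]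
    have h2 := pow_eq_zero_iff (two_ne_zero) |>.1 h1
    rw [hq2 i] at h2
    have := le_max_left (f q.1 i - b i) 0
    linarith
  have hq1 : q.1 = a := by
    have h1 := hmin q.1 hqD.1.1 hqb
    have h2 : R q = ∑ i, f q.1 i + (θ q.1 + 1 / 2 * ‖q.1 - a‖ ^ 2) := by simp [R, hq2]
    have h3 : ‖q.1 - a‖ ^ 2 = 0 := by nlinarith [sq_nonneg ‖q.1 - a‖]
    simpa [sub_eq_zero] using h3
  -- Distance below `1` makes the ball constraints in `D` inactive, so that only `Ω` contributes
  -- normals.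
  have hδ' : 0 < min δ 1 := lt_min hδ one_pos
  have hev1 : ∀ᶠ j in atTop, dist (p (φ j)).1 a < min δ 1 := by
    have := (continuous_fst.tendsto q).comp hq
    rw [hq1] at this
    exact this.eventually (Metric.ball_mem_nhds a hδ')
  have hev2 : ∀ᶠ j in atTop, ∀ i, dist ((p (φ j)).2 i) a < min δ 1 := by
    refine eventually_all.2 fun i => ?_
    have := (((continuous_apply i).comp continuous_snd).tendsto q).comp hq
    simp only [Function.comp_apply, hq2, hq1] at this
    exact this.eventually (Metric.ball_mem_nhds a hδ')
  obtain ⟨j, hj1, hj2⟩ := (hev1.and hev2).exists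
  obtain ⟨⟨z₀, z⟩, hz⟩ : ∃ r, r = p (φ j) := ⟨_, rfl⟩
  have hmn := hpmin (φ j)
  have hzD := hpD (φ j)
  rw [← hz] at hj1 hj2 hmn hzD
  obtain ⟨k, hk⟩ : ∃ k : ℝ, k = (φ j : ℝ) + 1 := ⟨_, rfl⟩
  have hk0 : 0 < k := by rw [hk]; positivity
  rw [← hk] at hmn
  simp only [lt_min_iff] at hj1 hj2
  set α : Fin m → ℝ := fun i => 1 + k * max (f (z i) i - b i) 0 with hα
  -- The objective already contains each `fᵢ`, so no multiplier `α i` degenerates and no constraint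
  -- qualification is needed.
  have hα1 : ∀ i, 1 ≤ α i := fun i => le_add_of_nonneg_right (by positivity)
  set s : ℝ := ∑ i, α i with hs
  have hs1 : 1 ≤ s :=
    (hα1 ⟨0, hm⟩).trans (Finset.single_le_sum (f := α)
      (fun i _ => zero_le_one.trans (hα1 i)) (Finset.mem_univ _))
  have hs0 : 0 < s := one_pos.trans_le hs1
  -- The weights are chosen so that `l i • v i = s⁻¹ • k • (z₀ - z i)`: their sum is the coupling
  -- part of the gradient in the base point, scaled by `s⁻¹`.
  refine ⟨z₀, z, fun i => (k / α i) • (z₀ - z i), fun i => α i / s, s⁻¹, hzD.1.1, hj1.1,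
    fun i => (hj2 i).1, fun i => ?_, fun i => div_nonneg (zero_le_one.trans (hα1 i)) hs0.le,
    by rw [← Finset.sum_div, div_self hs0.ne'], by positivity, inv_le_one_of_one_le₀ hs1, ?_⟩
  · refine regularNormal_epigraph_of_isMin (φ := fun y => f y i) hk0.le ?_
    filter_upwards [Metric.isOpen_ball.mem_nhds (show z i ∈ Metric.ball a 1 from (hj2 i).2)]
      with x hx
    -- Moving the `i`-th copy alone isolates `fᵢ`.
    have h := hmn (z₀, Function.update z i x) ⟨hzD.1, fun j _ => by
      by_cases hji : j = i
      · subst hji; simpa using (Metric.mem_ball.1 hx).le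
      · simpa [Function.update_of_ne hji] using hzD.2 j trivial⟩
    simp only [Q] at h
    rw [← Finset.add_sum_erase _ _ (Finset.mem_univ i),
      ← Finset.add_sum_erase _ _ (Finset.mem_univ i)] at h
    have he : ∑ j ∈ Finset.univ.erase i, (penalty k (b j) (f (Function.update z i x j) j) +
          k / 2 * ‖Function.update z i x j - z₀‖ ^ 2) =
        ∑ j ∈ Finset.univ.erase i, (penalty k (b j) (f (z j) j) + k / 2 * ‖z j - z₀‖ ^ 2) :=
      Finset.sum_congr rfl fun j hj => by
        rw [Function.update_of_ne (Finset.ne_of_mem_erase hj)]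
    rw [he, Function.update_self] at h
    linarith
  · have hd : HasFDerivAt
        (fun x => ∑ i, k / 2 * ‖z i - x‖ ^ 2 + (θ x + 1 / 2 * ‖x - a‖ ^ 2))
        (innerSL ℝ (∑ i, k • (z₀ - z i) + (g z₀ + (z₀ - a)))) z₀ := by
      have h1 : ∀ i ∈ Finset.univ, HasFDerivAt (fun x => k / 2 * ‖z i - x‖ ^ 2)
          (innerSL ℝ (k • (z₀ - z i))) z₀ := by
        intro i _
        refine ((((hasFDerivAt_id z₀).const_sub (z i)).norm_sq).const_mul (k / 2)).congr_fderiv ?_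
        ext y
        simp
        ring
      have h2 : HasFDerivAt (fun x => 1 / 2 * ‖x - a‖ ^ 2) (innerSL ℝ (z₀ - a)) z₀ := by
        refine ((((hasFDerivAt_id z₀).sub_const a).norm_sq).const_mul (1 / 2)).congr_fderiv ?_
        ext y
        simp
      refine ((HasFDerivAt.fun_sum h1).add ((hθ z₀).add h2)).congr_fderiv ?_
      simp only [map_add, map_sum]
    have hN := neg_mem_regularNormalCone_of_isMin (S := Ω) hd (by
      filter_upwards [self_mem_nhdsWithin, mem_nhdsWithin_of_mem_nhds
        (Metric.isOpen_ball.mem_nhds (show z₀ ∈ Metric.ball a 1 from hj1.2))] with x hx hx'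
      have h := hmn (x, z) ⟨⟨hx, (Metric.mem_ball.1 hx').le⟩, hzD.2⟩
      simp only [Q, Finset.sum_add_distrib] at h
      linarith)
    have hN' := smul_mem_regularNormalCone hN (inv_pos.2 hs0)
    have he : ∑ i, (α i / s) • (k / α i) • (z₀ - z i) = s⁻¹ • ∑ i, k • (z₀ - z i) := by
      rw [Finset.smul_sum]
      refine Finset.sum_congr rfl fun i _ => ?_
      have := (one_pos.trans_le (hα1 i)).ne'
      rw [smul_smul, smul_smul]
      congr 1
      field_simp
    rw [he, ← smul_add, ← smul_neg]
    exact hN'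

/-- Multiplier rule for minimizers of `∑ fᵢ + θ` on `{z ∈ Ω | f z ≤ b}`. -/
theorem exists_multipliers (hm : 0 < m) {f : E n → Fin m → ℝ} (hf : LocallyLipschitz f)
    {Ω : Set (E n)} (hcl : IsClosed Ω) {θ : E n → ℝ} {g : E n → E n}
    (hθ : ∀ z, HasFDerivAt θ (innerSL ℝ (g z)) z) (hg : Continuous g) {b : Fin m → ℝ} {a : E n}
    (ha : a ∈ Ω) (hb : f a ≤ b)
    (hmin : ∀ z ∈ Ω, f z ≤ b → ∑ i, f a i + θ a ≤ ∑ i, f z i + θ z) :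
    ∃ (v : Fin m → E n) (l : Fin m → ℝ) (μ : ℝ),
      (∀ i, v i ∈ subdifferential (fun y => f y i) a) ∧
      (∀ i, 0 ≤ l i) ∧ ∑ i, l i = 1 ∧ 0 ≤ μ ∧ μ ≤ 1 ∧
      -(∑ i, l i • v i + μ • g a) ∈ limitingNormalCone a Ω := by
  obtain ⟨K, t, ht, hK⟩ := hf a
  obtain ⟨r, hr, hrt⟩ := Metric.mem_nhds_iff.1 ht
  have hδ : ∀ j : ℕ, 0 < min r (1 / ((j : ℝ) + 1)) := fun j => lt_min hr (by positivity)
  choose z₀ z v l μ hz₀Ω hz₀ hz hv hl hl1 hμ hμ1 hN using fun j : ℕ =>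
    exists_approx_multipliers hm hf.continuous hcl hθ ha hb hmin (hδ j)
  have hvb : ∀ j i, ‖v j i‖ ≤ 2 * K + 1 := by
    intro j i
    refine norm_le_of_mem_regularNormalCone_epigraph (φ := fun y => f y i) K.2 ?_ (hv j i)
    have hzr : z j i ∈ Metric.ball a r := (hz j i).trans_le (min_le_left _ _)
    filter_upwards [Metric.isOpen_ball.mem_nhds hzr] with y hy
    have := hK.dist_le_mul y (hrt hy) (z j i) (hrt hzr)
    rw [← Real.dist_eq, ← dist_eq_norm]
    exact (dist_le_pi_dist (f y) (f (z j i)) i).trans this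
  have hl' : ∀ j i, l j i ≤ 1 := fun j i =>
    (Finset.single_le_sum (fun i _ => hl j i) (Finset.mem_univ i)).trans_eq (hl1 j)
  -- The Lipschitz bound on the subgradients puts all multiplier data in a compact set, so a
  -- subsequence converges.
  let D : Set ((Fin m → E n) × (Fin m → ℝ) × ℝ) :=
    (Set.univ.pi fun _ => Metric.closedBall 0 (2 * K + 1)) ×ˢ
      (Set.univ.pi fun _ => Set.Icc 0 1) ×ˢ Set.Icc 0 1
  have hD : IsCompact D := (isCompact_univ_pi fun _ => isCompact_closedBall _ _).prod
    ((isCompact_univ_pi fun _ => isCompact_Icc).prod isCompact_Icc)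
  obtain ⟨⟨v', l', μ'⟩, -, φ, hφ, hlim⟩ := hD.tendsto_subseq (x := fun j => (v j, l j, μ j))
    fun j => ⟨fun i _ => by simpa using hvb j i, fun i _ => ⟨hl j i, hl' j i⟩, hμ j, hμ1 j⟩
  have hlv : ∀ i, Tendsto (fun j => v (φ j) i) atTop (𝓝 (v' i)) := fun i =>
    (((continuous_apply i).comp continuous_fst).tendsto _).comp hlim
  have hll : ∀ i, Tendsto (fun j => l (φ j) i) atTop (𝓝 (l' i)) := fun i =>
    (((continuous_apply i).comp (continuous_fst.comp continuous_snd)).tendsto _).comp hlim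
  have hlμ : Tendsto (fun j => μ (φ j)) atTop (𝓝 μ') :=
    ((continuous_snd.comp continuous_snd).tendsto _).comp hlim
  have hto : ∀ y : ℕ → E n, (∀ j, dist (y j) a < min r (1 / ((j : ℝ) + 1))) →
      Tendsto (fun j => y (φ j)) atTop (𝓝 a) := by
    intro y hy
    refine Tendsto.comp (g := y) ?_ hφ.tendsto_atTop
    rw [tendsto_iff_dist_tendsto_zero]
    exact squeeze_zero (fun _ => dist_nonneg) (fun j => (hy j).le.trans (min_le_right _ _))
      tendsto_one_div_add_atTop_nhds_zero_nat
  have hz₀a := hto z₀ hz₀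
  refine ⟨v', l', μ', fun i => ?_, fun i => ge_of_tendsto' (hll i) fun j => hl _ i, ?_,
    ge_of_tendsto' hlμ fun j => hμ _, le_of_tendsto' hlμ fun j => hμ1 _, ?_⟩
  · have hza := hto (fun j => z j i) fun j => hz j i
    have hfza : Tendsto (fun j => f (z (φ j) i) i) atTop (𝓝 (f a i)) :=
      (((continuous_apply i).comp hf.continuous).tendsto a).comp hza
    exact ⟨fun j => WithLp.toLp 2 (z (φ j) i, f (z (φ j) i) i),
      fun j => WithLp.toLp 2 (v (φ j) i, -1), fun j => le_refl (f (z (φ j) i) i),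
      fun j => hv (φ j) i, tendsto_toLp_prodMk hza hfza,
      tendsto_toLp_prodMk (hlv i) tendsto_const_nhds⟩
  · refine tendsto_nhds_unique (tendsto_finsetSum Finset.univ fun i _ => hll i) ?_
    simp only [hl1]
    exact tendsto_const_nhds
  · refine ⟨fun j => z₀ (φ j), _, fun j => hz₀Ω _, fun j => hN (φ j), hz₀a, ?_⟩
    have h1 : Tendsto (fun j => g (z₀ (φ j)) + (z₀ (φ j) - a)) atTop (𝓝 (g a)) := by
      simpa using ((hg.tendsto a).comp hz₀a).add (hz₀a.sub_const a)
    exact ((tendsto_finsetSum Finset.univ fun i _ => (hll i).smul (hlv i)).add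
      (hlμ.smul h1)).neg

/-- A Pareto efficient solution is a zero of the Rabier function. -/
theorem IsParetoEfficient.rabier_eq_zero (hm : 0 < m) {f : E n → Fin m → ℝ}
    (hf : LocallyLipschitz f) {Ω : Set (E n)} (hcl : IsClosed Ω) {a : E n}
    (ha : IsParetoEfficient f Ω a) : rabier f Ω a = 0 := by
  obtain ⟨v, l, μ, hv, hl, hl1, -, -, hN⟩ := exists_multipliers hm hf hcl
    (θ := fun _ => 0) (g := fun _ => 0) (fun z => by simpa using hasFDerivAt_const (0 : ℝ) z)
    continuous_const ha.1 le_rfl (fun z hz hzb => by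
      have : f z = f a := by
        by_contra hne
        exact ha.2 ⟨z, hz, hzb, hne⟩
      rw [this])
  refine le_antisymm ((iInf₂_le (0 : E n) ?_).trans (by simp)) zero_le
  exact ⟨v, _, l, fun i => Or.inl (hv i), hN, hl, hl1, by simp⟩

/-! ### Logarithmic regularization on a section. -/

/-- The logarithm is coercive, its gradient is a multiple of `z`, as `Gam` requires, and `‖z‖` times
the norm of the gradient stays below `2ε`, as `KInfty` requires. -/
theorem hasFDerivAt_log_one_add_norm_sq (ε : ℝ) (z : E n) :
    HasFDerivAt (fun x : E n => ε * Real.log (1 + ‖x‖ ^ 2))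
      (innerSL ℝ ((2 * ε / (1 + ‖z‖ ^ 2)) • z)) z := by
  have h := (((hasFDerivAt_id z).norm_sq.const_add 1).log
    (by positivity : (1 : ℝ) + ‖z‖ ^ 2 ≠ 0)).const_mul ε
  refine h.congr_fderiv ?_
  ext y
  simp
  ring

/-- On the section `∑ fᵢ` is bounded below by the coordinate sum of the lower bound, so the
logarithm makes the objective coercive. -/
theorem exists_minimizer_add_log {f : E n → Fin m → ℝ} (hf : LocallyLipschitz f)
    {Ω : Set (E n)} (hcl : IsClosed Ω) {b : Fin m → ℝ} (hb : b ∈ f '' Ω)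
    (hbd : HasBoundedSection (f '' Ω) b) {ε : ℝ} (hε : 0 < ε) :
    ∃ x ∈ Ω, f x ≤ b ∧ ∀ z ∈ Ω, f z ≤ b →
      ∑ i, f x i + ε * Real.log (1 + ‖x‖ ^ 2) ≤ ∑ i, f z i + ε * Real.log (1 + ‖z‖ ^ 2) := by
  obtain ⟨x₀, hx₀, rfl⟩ := hb
  obtain ⟨c, hc⟩ := hbd
  have hfc := hf.continuous
  have hcont : Continuous fun x : E n => ∑ i, f x i + ε * Real.log (1 + ‖x‖ ^ 2) := by
    refine Continuous.add (by fun_prop) (continuous_const.mul (Continuous.log (by fun_prop) ?_))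
    intro x; positivity
  have hlog : Tendsto (fun x : E n => ∑ i, c i + ε * Real.log (1 + ‖x‖ ^ 2))
      (cocompact (E n)) atTop := by
    refine tendsto_atTop_add_const_left _ _ (Tendsto.const_mul_atTop hε
      (Real.tendsto_log_atTop.comp (tendsto_atTop_add_const_left _ _ ?_)))
    exact (tendsto_pow_atTop two_ne_zero).comp tendsto_norm_cocompact_atTop
  obtain ⟨x, hx, hxm⟩ := ContinuousOn.exists_isMinOn' (s := {x | x ∈ Ω ∧ f x ≤ f x₀})
    (x₀ := x₀) hcont.continuousOn (hcl.inter (isClosed_le hfc continuous_const)) ⟨hx₀, le_rfl⟩ (by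
      filter_upwards [(hlog.eventually_ge_atTop (∑ i, f x₀ i + ε * Real.log (1 + ‖x₀‖ ^ 2))).filter_mono
        inf_le_left, mem_inf_of_right (mem_principal_self _)] with x hx1 hx2
      refine hx1.trans (add_le_add_left (Finset.sum_le_sum fun i _ => ?_) _)
      exact hc _ ⟨⟨x, hx2.1, rfl⟩, hx2.2⟩ i)
  exact ⟨x, hx.1, hx.2, fun z hz hzb => hxm ⟨hz, hzb⟩⟩

/-- Minimizers of `∑ fᵢ + ε log (1 + ‖·‖²)` on a section lie in `Γ(f, Ω)` and almost annihilate
`‖x‖ ν(x)`. -/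
theorem mem_Gam_and_enorm_mul_rabier_le (hm : 0 < m) {f : E n → Fin m → ℝ}
    (hf : LocallyLipschitz f) {Ω : Set (E n)} (hcl : IsClosed Ω) {b : Fin m → ℝ} {ε : ℝ}
    (hε : 0 < ε) {x : E n} (hx : x ∈ Ω) (hxb : f x ≤ b)
    (hmin : ∀ z ∈ Ω, f z ≤ b →
      ∑ i, f x i + ε * Real.log (1 + ‖x‖ ^ 2) ≤ ∑ i, f z i + ε * Real.log (1 + ‖z‖ ^ 2)) :
    x ∈ Gam f Ω ∧ ‖x‖ₑ * rabier f Ω x ≤ ENNReal.ofReal (2 * ε) := by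
  obtain ⟨v, l, μ, hv, hl, hl1, hμ, hμ1, hN⟩ := exists_multipliers hm hf hcl
    (hasFDerivAt_log_one_add_norm_sq ε) (by
      have h : ∀ z : E n, 1 + ‖z‖ ^ 2 ≠ 0 := fun z => by positivity
      fun_prop (disch := exact h _)) hx hxb hmin
  obtain ⟨c, hc⟩ : ∃ c, c = μ * (2 * ε / (1 + ‖x‖ ^ 2)) := ⟨_, rfl⟩
  have hc0 : 0 ≤ c := by rw [hc]; positivity
  have hc1 : 0 < 1 + c := by positivity
  rw [smul_smul, ← hc] at hN
  -- The factor `(1 + c)⁻¹` turns `∑ l i = 1` with coefficient `c` of `x` into the normalization of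
  -- `Gam`; the bound on `rabier` uses the unscaled relation.
  refine ⟨⟨hx, v, fun i => Or.inl (hv i), fun i => (1 + c)⁻¹ * l i, (1 + c)⁻¹ * c,
    fun i => mul_nonneg (inv_nonneg.2 hc1.le) (hl i), ?_, _,
    smul_mem_limitingNormalCone hN (inv_pos.2 hc1), ?_⟩, ?_⟩
  · rw [← Finset.mul_sum, hl1, abs_of_nonneg (by positivity)]
    field_simp
  · simp only [mul_smul, ← Finset.smul_sum, smul_neg, smul_add]
    abel
  · have hr : rabier f Ω x ≤ ‖-(c • x)‖ₑ := iInf₂_le _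
      ⟨v, _, l, fun i => Or.inl (hv i), hN, hl, hl1, by abel⟩
    calc ‖x‖ₑ * rabier f Ω x ≤ ‖x‖ₑ * ‖-(c • x)‖ₑ := by gcongr
      _ = ENNReal.ofReal (‖x‖ * ‖-(c • x)‖) := by
        rw [ENNReal.ofReal_mul (norm_nonneg _), ofReal_norm, ofReal_norm]
      _ ≤ ENNReal.ofReal (2 * ε) := by
        refine ENNReal.ofReal_le_ofReal ?_
        rw [norm_neg, norm_smul, Real.norm_of_nonneg hc0, hc]
        have h1 : ‖x‖ ^ 2 / (1 + ‖x‖ ^ 2) ≤ 1 := by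
          rw [div_le_one (by positivity)]; linarith
        calc ‖x‖ * (μ * (2 * ε / (1 + ‖x‖ ^ 2)) * ‖x‖)
            = μ * (2 * ε) * (‖x‖ ^ 2 / (1 + ‖x‖ ^ 2)) := by ring
          _ ≤ 1 * (2 * ε) * 1 := by gcongr
          _ = 2 * ε := by ring

theorem KInfty_subset_KTildeInfty (f : E n → Fin m → ℝ) (Ω : Set (E n)) (b : Fin m → ℝ) :
    KInfty f Ω b ⊆ KTildeInfty f Ω b := by
  rintro y ⟨x, hx, hxb, hx1, hx2, hx3⟩
  refine ⟨x, hx, hxb, hx1, hx2, tendsto_of_tendsto_of_tendsto_of_le_of_le' tendsto_const_nhds hx3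
    (Eventually.of_forall fun _ => zero_le) ?_⟩
  filter_upwards [hx1.eventually_ge_atTop 1] with k hk
  refine le_mul_of_one_le_left zero_le ?_
  rw [← ofReal_norm]
  exact ENNReal.one_le_ofReal.2 hk

/-- If the section at `b` is bounded and the values which are asymptotic both in the sense of
`KInfty` and of `TInfty` are attained on the section, then a Pareto efficient solution exists. -/
theorem exists_isParetoEfficient (hm : 0 < m) {f : E n → Fin m → ℝ}
    (hf : LocallyLipschitz f) {Ω : Set (E n)} (hcl : IsClosed Ω) {b : Fin m → ℝ}
    (hb : b ∈ f '' Ω) (hbd : HasBoundedSection (f '' Ω) b)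
    (hsub : KInfty f Ω b ∩ TInfty f Ω b ⊆ KZero f Ω b) : ∃ x, IsParetoEfficient f Ω x := by
  have hε : ∀ k : ℕ, (0 : ℝ) < 1 / ((k : ℝ) + 1) := fun k => by positivity
  choose x hxΩ hxb hxm using fun k : ℕ => exists_minimizer_add_log hf hcl hb hbd (hε k)
  have hx := fun k => mem_Gam_and_enorm_mul_rabier_le hm hf hcl (hε k) (hxΩ k) (hxb k) (hxm k)
  obtain ⟨c, hc⟩ := hbd
  obtain ⟨y, -, φ, hφ, hy⟩ := (isCompact_Icc (a := c) (b := b)).tendsto_subseq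
    (x := fun k => f (x k)) fun k => ⟨hc _ ⟨⟨x k, hxΩ k, rfl⟩, hxb k⟩, hxb k⟩
  replace hy : Tendsto (fun k => f (x (φ k))) atTop (𝓝 y) := hy
  have h0 : Tendsto (fun k => 1 / ((φ k : ℝ) + 1)) atTop (𝓝 0) :=
    tendsto_one_div_add_atTop_nhds_zero_nat.comp hφ.tendsto_atTop
  have hinf : ∀ z ∈ Ω, f z ≤ b → ∑ i, y i ≤ ∑ i, f z i := by
    intro z hz hzb
    have h1 : Tendsto (fun k => ∑ i, f (x (φ k)) i) atTop (𝓝 (∑ i, y i)) :=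
      tendsto_finsetSum Finset.univ fun i _ => ((continuous_apply i).tendsto y).comp hy
    -- For fixed `z` the regularizing term vanishes as `ε → 0`.
    have h2 := (h0.mul_const (Real.log (1 + ‖z‖ ^ 2))).const_add (∑ i, f z i)
    rw [zero_mul, add_zero] at h2
    refine le_of_tendsto_of_tendsto' h1 h2 fun k => le_trans ?_ (hxm (φ k) z hz hzb)
    have : 0 ≤ Real.log (1 + ‖x (φ k)‖ ^ 2) :=
      Real.log_nonneg (le_add_of_nonneg_right (by positivity))
    have := hε (φ k)
    exact le_add_of_nonneg_right (by positivity)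
  have hatt : ∃ a ∈ Ω, f a ≤ b ∧ y = f a := by
    by_cases h : Tendsto (fun k => ‖x (φ k)‖) atTop atTop
    · obtain ⟨a, ha, hab, -, hya⟩ := hsub ⟨⟨fun k => x (φ k), fun k => hxΩ _, fun k => hxb _, h, hy,
        tendsto_of_tendsto_of_tendsto_of_le_of_le tendsto_const_nhds
          (by simpa using ENNReal.tendsto_ofReal (h0.const_mul 2)) (fun _ => zero_le)
          (fun k => (hx (φ k)).2)⟩, ⟨fun k => x (φ k), fun k => (hx _).1, fun k => hxb _, h, hy⟩⟩
      exact ⟨a, ha, hab, hya⟩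
    -- Otherwise infinitely many minimizers lie in one ball, and a cluster point attains `y`.
    · rw [tendsto_atTop] at h
      push Not at h
      obtain ⟨r, hr⟩ := h
      obtain ⟨a, -, ψ, hψ, ha⟩ := (isCompact_closedBall (0 : E n) r).tendsto_subseq'
        (x := fun k => x (φ k)) (hr.mono fun k hk => by simpa using hk.le)
      have hfa := (hf.continuous.tendsto a).comp ha
      refine ⟨a, hcl.mem_of_tendsto ha (Eventually.of_forall fun k => hxΩ _),
        le_of_tendsto' hfa fun k => hxb _,
        tendsto_nhds_unique (hy.comp hψ.tendsto_atTop) hfa⟩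
  obtain ⟨a, ha, hab, rfl⟩ := hatt
  refine ⟨a, ha, ?_⟩
  rintro ⟨z, hz, hza, hne⟩
  refine hne (funext fun i => ?_)
  -- `a` minimizes the coordinate sum, so a value that is componentwise smaller has the same sum and
  -- must coincide.
  have := (Finset.sum_eq_sum_iff_of_le fun i _ => hza i).1
    (le_antisymm (Finset.sum_le_sum fun i _ => hza i) (hinf z hz (hza.trans hab)))
  exact this i (Finset.mem_univ i)

/-! ### The section at an efficient value, and the equivalences. -/

theorem IsParetoEfficient.eq_of_tendsto {f : E n → Fin m → ℝ} {Ω : Set (E n)} {a : E n}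
    (ha : IsParetoEfficient f Ω a) {x : ℕ → E n} (hx : ∀ k, x k ∈ Ω) (hxa : ∀ k, f (x k) ≤ f a)
    {y : Fin m → ℝ} (hy : Tendsto (fun k => f (x k)) atTop (𝓝 y)) : y = f a := by
  have h : ∀ k, f (x k) = f a := fun k => by
    by_contra hne
    exact ha.2 ⟨x k, hx k, hxa k, hne⟩
  simp only [h] at hy
  exact tendsto_nhds_unique hy tendsto_const_nhds

theorem IsParetoEfficient.hasBoundedSection {f : E n → Fin m → ℝ} {Ω : Set (E n)} {a : E n}
    (ha : IsParetoEfficient f Ω a) : HasBoundedSection (f '' Ω) (f a) := by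
  refine ⟨f a, ?_⟩
  rintro _ ⟨⟨z, hz, rfl⟩, hza⟩
  by_contra hne
  exact ha.2 ⟨z, hz, hza, fun h => hne h.ge⟩

end VecOpt

theorem theorem4p1 {n m : ℕ} (hm : 0 < m)
    (f : VecOpt.E n → Fin m → ℝ) (hf : LocallyLipschitz f)
    (Ω : Set (VecOpt.E n)) (hne : Ω.Nonempty) (hcl : IsClosed Ω) :
    List.TFAE [
      ∃ x, VecOpt.IsParetoEfficient f Ω x,
      ∃ b ∈ f '' Ω, VecOpt.HasBoundedSection (f '' Ω) b ∧
        VecOpt.KTildeInfty f Ω b ⊆ VecOpt.KZero f Ω b,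
      ∃ b ∈ f '' Ω, VecOpt.HasBoundedSection (f '' Ω) b ∧
        VecOpt.KInfty f Ω b ⊆ VecOpt.KZero f Ω b,
      ∃ b ∈ f '' Ω, VecOpt.HasBoundedSection (f '' Ω) b ∧
        VecOpt.TInfty f Ω b ⊆ VecOpt.KZero f Ω b] := by
  tfae_have 1 → 2 := by
    rintro ⟨a, ha⟩
    refine ⟨f a, ⟨a, ha.1, rfl⟩, ha.hasBoundedSection, ?_⟩
    rintro y ⟨x, hx, hxa, -, hy, -⟩
    exact ⟨a, ha.1, le_rfl, ha.rabier_eq_zero hm hf hcl, ha.eq_of_tendsto hx hxa hy⟩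
  tfae_have 2 → 3 := fun ⟨b, hb, hbd, h⟩ =>
    ⟨b, hb, hbd, (VecOpt.KInfty_subset_KTildeInfty f Ω b).trans h⟩
  tfae_have 3 → 1 := fun ⟨b, hb, hbd, h⟩ =>
    VecOpt.exists_isParetoEfficient hm hf hcl hb hbd (Set.inter_subset_left.trans h)
  tfae_have 1 → 4 := by
    rintro ⟨a, ha⟩
    refine ⟨f a, ⟨a, ha.1, rfl⟩, ha.hasBoundedSection, ?_⟩
    rintro y ⟨x, hx, hxa, -, hy⟩
    exact ⟨a, ha.1, le_rfl, ha.rabier_eq_zero hm hf hcl,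
      ha.eq_of_tendsto (fun k => (hx k).1) hxa hy⟩
  tfae_have 4 → 1 := fun ⟨b, hb, hbd, h⟩ =>
    VecOpt.exists_isParetoEfficient hm hf hcl hb hbd (Set.inter_subset_right.trans h)
  tfae_finish
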